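/- A graph $G$ contains a graph $H$ as an immersion if there are an injective map $\phi\colon V(H)\to V(G)$ and, for every edge $uv\in E(H)$, a path $P_{uv}$ in $G$ with endpoints $\phi(u)$ and $\phi(v)$, such that the paths $P_{uv}$, $uv\in E(H)$, are pairwise edge-disjoint. Let $\beta_1,\beta_2,\beta_3,\dots$ be rational numbers such that $\beta_1=1$, $\beta_2=\frac52$, and for every $i\ge 3$: * $\beta_i\ge\beta_{i-1}+2$, and * $\beta_i\ge\beta_s+\beta_t+\frac{2i-1}{i}$ for all $s,t\in\{2,\dots,i-2\}$ with $s+t=i$. Let $\alpha\ge 1$ be an integer and let $G$ be a finite simple graph on $n$ vertices with independence number at most $\alpha$. Then $G$ contains an immersion of a clique on at least $\left\lfloor \frac{n}{\beta_\alpha}\right\rfloor-1$ vertices. -/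

import Mathlib

/-- `H.IsImmersedIn G`: the graph `G` contains the graph `H` as an immersion. There are an injection
`φ` of the vertices of `H` into those of `G` and, for every edge `uv` of `H`, a path `P_{uv}` in `G`
with endpoints `φ u` and `φ v`, such that the paths of distinct edges of `H` have no edge in common.
The path of an edge is indexed by the two orientations of the edge; the condition
`P h.symm = (P h).reverse` says that both give the same path. -/
def SimpleGraph.IsImmersedIn {W V : Type*} (H : SimpleGraph W) (G : SimpleGraph V) : Prop :=
  ∃ (φ : W ↪ V) (P : ∀ ⦃u v : W⦄, H.Adj u v → G.Walk (φ u) (φ v)),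
    (∀ ⦃u v : W⦄ (h : H.Adj u v), (P h).IsPath) ∧
    (∀ ⦃u v : W⦄ (h : H.Adj u v), P h.symm = (P h).reverse) ∧
    (∀ ⦃u v x y : W⦄ (h : H.Adj u v) (k : H.Adj x y), s(u, v) ≠ s(x, y) →
      Disjoint (P h).edgeSet (P k).edgeSet)

/-! It suffices to connect the pairs of branch vertices by edge-disjoint subgraphs, since each then
contains a path. Strong induction on `α` shows that a set of at least `β α * k` vertices carries
such a structure on `k - 1` branch vertices (`linkedIn_of_superadditive`).

For `α = 1` the set is a clique. For `α = 2`, `5 * k` vertices give `2 * k` branch vertices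
(`linkedIn_of_indepLE_two`): in an edge-minimal graph there is a large clique or an induced
pentagon, and `IsPentagon.extend` adds two opposite vertices of the pentagon to a structure outside
it.

For `α ≥ 3`, remove a maximum independent set `I`, apply induction on `k` to the rest, and add one
vertex of `I`. The connections to it run through `I` and outside vertices. By a Menger-type theorem
(`exists_connector_assignment`) they exist if many outside vertices see both sides of every
bipartition of `I`. If few did, the vertices that miss one side would be numerous; as they have
smaller independence number, the induction on `α` would already apply to them. -/

namespace CliqueImmersion

/-! ### Immersions as families of edge-disjoint connecting subgraphs -/

/-- The spanning subgraph of `G` formed by the edges with both ends in `S`. -/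
def within {V : Type*} (G : SimpleGraph V) (S : Finset V) : SimpleGraph V where
  Adj u v := G.Adj u v ∧ u ∈ S ∧ v ∈ S
  symm := ⟨fun _ _ h => ⟨h.1.symm, h.2.2, h.2.1⟩⟩
  loopless := ⟨fun _ h => h.1.ne rfl⟩

/-- The spanning subgraph of `G` formed by the edges between `C` and its complement to which `L`
gives the label `l`; the first argument of `L` is the end in `C`. -/
def labelled {V γ : Type*} (G : SimpleGraph V) (C : Finset V) (L : V → V → γ) (l : γ) :
    SimpleGraph V where
  Adj u v := G.Adj u v ∧ ((u ∈ C ∧ v ∉ C ∧ L u v = l) ∨ (v ∈ C ∧ u ∉ C ∧ L v u = l))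
  symm := ⟨fun _ _ h => ⟨h.1.symm, h.2.symm⟩⟩
  loopless := ⟨fun _ h => h.1.ne rfl⟩

/-- The vertices of `Q` are the branch vertices of a clique immersion in `F`, given by pairwise
edge-disjoint subgraphs that connect the pairs. -/
def Linked {V : Type*} (F : SimpleGraph V) (Q : Finset V) : Prop :=
  ∃ H : Sym2 V → SimpleGraph V, (∀ e, H e ≤ F) ∧ (∀ e f, e ≠ f → Disjoint (H e) (H f)) ∧
    ∀ u ∈ Q, ∀ v ∈ Q, u ≠ v → (H s(u, v)).Reachable u v

/-- The subgraph of `G` induced by `S` has a clique immersion with `t` branch vertices. -/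
def LinkedIn {V : Type*} (G : SimpleGraph V) (S : Finset V) (t : ℕ) : Prop :=
  ∃ Q ⊆ S, Q.card = t ∧ Linked (within G S) Q

/-- Independent sets of `G` inside `S` have at most `a` vertices. -/
def IndepLE {V : Type*} (G : SimpleGraph V) (S : Finset V) (a : ℕ) : Prop :=
  ∀ J ⊆ S, G.IsIndepSet J → J.card ≤ a

section

variable {V : Type*} {G G' : SimpleGraph V} {S S' C Q : Finset V}

theorem disjoint_of_forall_not_adj {F F' : SimpleGraph V}
    (h : ∀ u v, F.Adj u v → ¬ F'.Adj u v) : Disjoint F F' := by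
  rw [disjoint_iff_inf_le]
  intro u v huv
  exact h u v huv.1 huv.2

theorem within_le : within G S ≤ G := fun _ _ h => h.1

theorem within_mono (hG : G ≤ G') (hS : S ⊆ S') : within G S ≤ within G' S' :=
  fun _ _ h => ⟨hG h.1, hS h.2.1, hS h.2.2⟩

theorem Linked.mono {F F' : SimpleGraph V} (hF : F ≤ F') {Q' : Finset V} (hQ : Q' ⊆ Q)
    (h : Linked F Q) : Linked F' Q' := by
  obtain ⟨H, h1, h2, h3⟩ := h
  exact ⟨H, fun e => (h1 e).trans hF, h2, fun u hu v hv => h3 u (hQ hu) v (hQ hv)⟩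

theorem LinkedIn.mono {t t' : ℕ} (hG : G ≤ G') (hS : S ⊆ S') (ht : t' ≤ t)
    (h : LinkedIn G S t) : LinkedIn G' S' t' := by
  obtain ⟨Q, hQ, hc, h⟩ := h
  obtain ⟨Q', hQ', hc'⟩ := Finset.exists_subset_card_eq (hc ▸ ht : t' ≤ Q.card)
  exact ⟨Q', (hQ'.trans hQ).trans hS, hc', h.mono (within_mono hG hS) hQ'⟩

theorem linkedIn_zero (G : SimpleGraph V) (S : Finset V) : LinkedIn G S 0 :=
  ⟨∅, Finset.empty_subset _, rfl, fun _ => ⊥, fun _ => bot_le, fun _ _ _ => disjoint_bot_left,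
    fun u hu => absurd hu (Finset.notMem_empty u)⟩

theorem linkedIn_of_isClique {K : Finset V} (hK : K ⊆ S) (hG : G.IsClique K) {t : ℕ}
    (ht : t ≤ K.card) : LinkedIn G S t := by
  refine LinkedIn.mono le_rfl subset_rfl ht ⟨K, hK, rfl,
    fun e => SimpleGraph.fromEdgeSet {e} ⊓ within G S, fun e => inf_le_right, ?_, ?_⟩
  · intro e f hef
    refine disjoint_of_forall_not_adj fun u v h h' => hef ?_
    have h1 := h.1
    have h2 := h'.1
    simp only [SimpleGraph.fromEdgeSet_adj, Set.mem_singleton_iff] at h1 h2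
    exact h1.1.symm.trans h2.1
  · intro u hu v hv huv
    refine SimpleGraph.Adj.reachable ⟨?_, hG hu hv huv, hK hu, hK hv⟩
    simpa using huv

theorem labelled_disjoint {γ : Type*} (L : V → V → γ) {l l' : γ} (h : l ≠ l') :
    Disjoint (labelled G C L l) (labelled G C L l') := by
  refine disjoint_of_forall_not_adj ?_
  rintro u v ⟨-, ⟨hu, hv, rfl⟩ | ⟨hv, hu, rfl⟩⟩ ⟨-, ⟨hu', hv', h'⟩ | ⟨hv', hu', h'⟩⟩
  · exact h h'
  · exact hv hv'
  · exact hu hu'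
  · exact h h'

theorem within_disjoint_labelled {γ : Type*} (L : V → V → γ) (l : γ)
    (h : S ⊆ C ∨ Disjoint S C) : Disjoint (within G S) (labelled G' C L l) := by
  refine disjoint_of_forall_not_adj ?_
  rintro u v ⟨-, hu, hv⟩ ⟨-, ⟨hu', hv', -⟩ | ⟨hv', hu', -⟩⟩
  · rcases h with h | h
    · exact hv' (h hv)
    · exact Finset.disjoint_left.1 h hu hu'
  · rcases h with h | h
    · exact hu' (h hu)
    · exact Finset.disjoint_left.1 h hv hv'

theorem within_disjoint_within (h : Disjoint S S') : Disjoint (within G S) (within G S') := by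
  refine disjoint_of_forall_not_adj ?_
  rintro u v ⟨-, hu, -⟩ ⟨-, hu', -⟩
  exact Finset.disjoint_left.1 h hu hu'

theorem labelled_le {γ : Type*} {L : V → V → γ} {l : γ} : labelled G C L l ≤ G :=
  fun _ _ h => h.1

theorem labelled_adj {γ : Type*} {L : V → V → γ} {l : γ} {c o : V} (h : G.Adj c o) (hc : c ∈ C)
    (ho : o ∉ C) (hl : L c o = l) : (labelled G C L l).Adj c o := ⟨h, Or.inl ⟨hc, ho, hl⟩⟩

/-- A new branch vertex `x` can be added to a clique immersion in `F` when it is connected to the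
old ones by pairwise edge-disjoint subgraphs that avoid `F`. -/
theorem Linked.insert_branch [DecidableEq V] {F : SimpleGraph V} (h : Linked F Q) {x : V} (hx : x ∉ Q)
    (K : V → SimpleGraph V) (hK : ∀ p q, p ≠ q → Disjoint (K p) (K q))
    (hF : ∀ q, Disjoint F (K q)) (hr : ∀ q ∈ Q, (K q).Reachable q x) :
    Linked (F ⊔ ⨆ q, K q) (insert x Q) := by
  obtain ⟨H, h1, h2, h3⟩ := h
  have key : ∀ e : Sym2 V, ∃ D : SimpleGraph V, (x ∈ e → ∃ q, e = s(q, x) ∧ D = K q) ∧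
      (x ∉ e → D = H e) := by
    intro e
    by_cases he : x ∈ e
    · obtain ⟨q, rfl⟩ := Sym2.mem_iff_exists.1 he
      exact ⟨K q, fun _ => ⟨q, Sym2.eq_swap, rfl⟩, fun h => absurd he h⟩
    · exact ⟨H e, fun h => absurd h he, fun _ => rfl⟩
  choose D hD hD' using key
  have hxq : ∀ q, D s(q, x) = K q := by
    intro q
    obtain ⟨q', hq, hq'⟩ := hD s(q, x) (by simp)
    rw [hq']
    rw [Sym2.congr_left] at hq
    rw [hq]
  refine ⟨D, ?_, ?_, ?_⟩
  · intro e
    by_cases he : x ∈ e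
    · obtain ⟨q, -, h⟩ := hD e he
      rw [h]
      exact (le_iSup K q).trans le_sup_right
    · rw [hD' e he]
      exact (h1 e).trans le_sup_left
  · intro e f hef
    by_cases he : x ∈ e <;> by_cases hf : x ∈ f
    · obtain ⟨q, rfl, h⟩ := hD e he
      obtain ⟨p, rfl, h'⟩ := hD f hf
      rw [h, h']
      exact hK _ _ fun hqp => hef (by rw [hqp])
    · obtain ⟨q, -, h⟩ := hD e he
      rw [h, hD' f hf]
      exact ((hF q).mono_left (h1 f)).symm
    · obtain ⟨q, -, h⟩ := hD f hf
      rw [h, hD' e he]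
      exact (hF q).mono_left (h1 e)
    · rw [hD' e he, hD' f hf]
      exact h2 e f hef
  · intro u hu v hv huv
    rcases Finset.mem_insert.1 hu with rfl | hu' <;> rcases Finset.mem_insert.1 hv with rfl | hv'
    · exact absurd rfl huv
    · rw [Sym2.eq_swap, hxq]
      exact (hr v hv').symm
    · rw [hxq]
      exact hr u hu'
    · have : x ∉ s(u, v) := by
        rw [Sym2.mem_iff]
        rintro (rfl | rfl) <;> contradiction
      rw [hD' _ this]
      exact h3 u hu' v hv' huv

/-- A path is chosen in each connecting subgraph; disjointness of the subgraphs makes the paths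
edge-disjoint. -/
theorem LinkedIn.isImmersedIn {t : ℕ} (h : LinkedIn G S t) :
    (⊤ : SimpleGraph (Fin t)).IsImmersedIn G := by
  classical
  obtain ⟨Q, -, hc, H, h1, h2, h3⟩ := h
  let e : Fin t ≃ Q := (Q.equivFinOfCardEq hc).symm
  have hφ : Function.Injective fun i => (e i : V) :=
    Subtype.val_injective.comp e.injective
  have hp : ∀ i j, i ≠ j → ∃ p : (H s((e i : V), (e j : V))).Walk (e i) (e j), p.IsPath :=
    fun i j hij => (h3 _ (e i).2 _ (e j).2 (hφ.ne hij)).exists_isPath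
  have hp' : ∀ i j, i ≠ j → ∃ p : G.Walk (e i) (e j), p.IsPath ∧
      p.edgeSet ⊆ (H s((e i : V), (e j : V))).edgeSet := by
    intro i j hij
    obtain ⟨p, hp⟩ := hp i j hij
    refine ⟨p.mapLe ((h1 _).trans within_le), hp.mapLe _, ?_⟩
    intro d hd
    simp only [SimpleGraph.Walk.mem_edgeSet, SimpleGraph.Walk.edges_mapLe_eq_edges] at hd
    exact p.edges_subset_edgeSet hd
  choose p hp1 hp2 using hp'
  -- The order of `Fin t` selects one orientation of each edge; the other gets the reversed path.
  let P : ∀ ⦃i j : Fin t⦄, (⊤ : SimpleGraph (Fin t)).Adj i j → G.Walk (e i : V) (e j) :=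
    fun i j h => if i < j then p i j h.ne else (p j i h.ne.symm).reverse
  have hP : ∀ ⦃i j : Fin t⦄ (h : (⊤ : SimpleGraph (Fin t)).Adj i j),
      (P h).edgeSet ⊆ (H s((e i : V), (e j : V))).edgeSet := by
    intro i j h
    by_cases hij : i < j
    · simpa [P, hij] using hp2 i j h.ne
    · have := hp2 j i h.ne.symm
      rw [Sym2.eq_swap] at this
      simpa [P, hij] using this
  refine ⟨⟨fun i => (e i : V), hφ⟩, P, ?_, ?_, ?_⟩
  · intro i j h
    by_cases hij : i < j
    · simpa [P, hij] using hp1 i j h.ne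
    · simpa [P, hij] using hp1 j i h.ne.symm
  · intro i j h
    rcases lt_or_gt_of_ne h.ne with hij | hij
    · simp [P, hij, hij.not_gt]
    · simp [P, hij, hij.not_gt]
  · intro i j k l h h' hne
    have hd : Disjoint (H s((e i : V), (e j : V))) (H s((e k : V), (e l : V))) := by
      refine h2 _ _ fun heq => hne ?_
      have : Sym2.map (fun i => (e i : V)) s(i, j) = Sym2.map (fun i => (e i : V)) s(k, l) := heq
      exact Sym2.map.injective hφ this
    exact (SimpleGraph.disjoint_edgeSet.2 hd).mono (hP h) (hP h')

end

/-! ### A Menger-type theorem for hypergraph connectors -/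

/-- Counting the sets of a family that cross a given set is submodular. -/
theorem card_crossing_union_add_inter_le {ι ρ : Type*} [DecidableEq ι] (R : Finset ρ)
    (N : ρ → Finset ι) (U W : Finset ι) :
    (R.filter fun w => ¬ Disjoint (N w) (U ∪ W) ∧ ¬ N w ⊆ U ∪ W).card +
      (R.filter fun w => ¬ Disjoint (N w) (U ∩ W) ∧ ¬ N w ⊆ U ∩ W).card ≤
    (R.filter fun w => ¬ Disjoint (N w) U ∧ ¬ N w ⊆ U).card +
      (R.filter fun w => ¬ Disjoint (N w) W ∧ ¬ N w ⊆ W).card := by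
  simp only [Finset.card_filter, ← Finset.sum_add_distrib]
  refine Finset.sum_le_sum fun v _ => ?_
  have e3 : Disjoint (N v) U → Disjoint (N v) (U ∩ W) :=
    fun h => h.mono_right Finset.inter_subset_left
  have e4 : Disjoint (N v) W → Disjoint (N v) (U ∩ W) :=
    fun h => h.mono_right Finset.inter_subset_right
  have e5 : N v ⊆ U → N v ⊆ U ∪ W := fun h => h.trans Finset.subset_union_left
  have e6 : N v ⊆ W → N v ⊆ U ∪ W := fun h => h.trans Finset.subset_union_right
  by_cases d1 : Disjoint (N v) U <;> by_cases d2 : Disjoint (N v) W <;>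
    by_cases s1 : N v ⊆ U <;> by_cases s2 : N v ⊆ W <;>
    simp only [Finset.disjoint_union_right, Finset.subset_inter_iff, d1, d2, s1, s2, e3, e4, e5,
      e6, not_true_eq_false, not_false_eq_true, and_true, and_false, false_and, true_and,
      if_true, if_false] <;>
    first | omega | (split_ifs <;> omega)

/-- The Menger-type condition for connecting each `q ∈ Q` to `x` by disjoint families of connectors:
a connector `w` joins the points of `N w`, and `q` is attached to the points of `M q`. -/
theorem exists_connector_assignment {ι κ ρ : Type*} [DecidableEq ι] [DecidableEq κ] [DecidableEq ρ]
    [Nonempty κ] (I : Finset ι) {x : ι} (hx : x ∈ I) (Q : Finset κ) (N : ρ → Finset ι) :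
    ∀ (m : ℕ) (R : Finset ρ) (M : κ → Finset ι), R.card = m →
      (∀ q ∈ Q, M q ⊆ I ∧ (M q).Nonempty) → (∀ w ∈ R, N w ⊆ I) →
      (∀ U ⊆ I, x ∈ U → (Q.filter fun q => Disjoint (M q) U).card ≤
        (R.filter fun w => ¬ Disjoint (N w) U ∧ ¬ N w ⊆ U).card) →
      ∃ f : ρ → κ, ∀ q ∈ Q, ∀ U ⊆ I, x ∈ U → Disjoint (M q) U →
        ∃ w ∈ R, f w = q ∧ ¬ Disjoint (N w) U ∧ ¬ N w ⊆ U := by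
  intro m
  induction m with
  | zero =>
    intro R M hR hM hN hcut
    obtain rfl := Finset.card_eq_zero.1 hR
    refine ⟨fun _ => Classical.arbitrary κ, fun q hq U hU hxU hd => ?_⟩
    have := hcut U hU hxU
    simp only [Finset.filter_empty, Finset.card_empty, Nat.le_zero, Finset.card_eq_zero,
      Finset.filter_eq_empty_iff] at this
    exact absurd hd (this hq)
  | succ m ih =>
    intro R M hR hM hN hcut
    by_cases hall : ∀ q ∈ Q, x ∈ M q
    · refine ⟨fun _ => Classical.arbitrary κ, fun q hq U hU hxU hd => ?_⟩
      exact absurd hxU (Finset.disjoint_left.1 hd (hall q hq))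
    push Not at hall
    obtain ⟨q, hq, hqx⟩ := hall
    let cr : Finset ι → ℕ := fun U => (R.filter fun w => ¬ Disjoint (N w) U ∧ ¬ N w ⊆ U).card
    let ms : Finset ι → ℕ := fun U => (Q.filter fun q => Disjoint (M q) U).card
    have hcut' : ∀ U ⊆ I, x ∈ U → ms U ≤ cr U := hcut
    -- The tight cuts that meet `M q`: with `hcut'` the inequality is an equality. The whole of `I`
    -- is one, as nothing crosses it.
    let T : Finset (Finset ι) :=
      I.powerset.filter fun U => x ∈ U ∧ cr U ≤ ms U ∧ ¬ Disjoint (M q) U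
    have hTI : I ∈ T := by
      simp only [T, Finset.mem_filter, Finset.mem_powerset, subset_rfl, hx, true_and]
      refine ⟨?_, ?_⟩
      · have : cr I = 0 := by
          simp only [cr, Finset.card_eq_zero, Finset.filter_eq_empty_iff]
          exact fun w hw h => h.2 (hN w hw)
        omega
      · intro hd
        obtain ⟨i, hi⟩ := (hM q hq).2
        exact Finset.disjoint_left.1 hd hi ((hM q hq).1 hi)
    obtain ⟨U, hUT, hUmin⟩ := T.exists_min_image Finset.card ⟨I, hTI⟩
    simp only [T, Finset.mem_filter, Finset.mem_powerset] at hUT hUmin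
    obtain ⟨hUI, hxU, hUt, hqU⟩ := hUT
    -- Taking `M q` out of the tight cut `U` raises the demand, so some connector crosses `U \ M q`
    -- but not `U`. It lies in `U` and joins `M q` to a point outside it.
    obtain ⟨w, hwR, hw1, hw2, hwU⟩ : ∃ w ∈ R, ¬ Disjoint (N w) (U \ M q) ∧
        ¬ Disjoint (N w) (M q) ∧ N w ⊆ U := by
      have h1 : ms (U \ M q) ≤ cr (U \ M q) :=
        hcut' _ (Finset.sdiff_subset.trans hUI) (Finset.mem_sdiff.2 ⟨hxU, hqx⟩)
      have h2 : ms U < ms (U \ M q) := by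
        refine Finset.card_lt_card (Finset.ssubset_iff_of_subset ?_ |>.2 ⟨q, ?_, ?_⟩)
        · exact Finset.monotone_filter_right _
            fun p _ hp => Disjoint.mono_right Finset.sdiff_subset hp
        · simpa [hq] using Finset.disjoint_sdiff
        · simp [hqU]
      have h3 : cr U < cr (U \ M q) := by omega
      obtain ⟨w, hw, hw'⟩ := Finset.exists_mem_notMem_of_card_lt_card h3
      simp only [Finset.mem_filter] at hw hw'
      have hwU : N w ⊆ U := by
        by_contra hcon
        exact hw' ⟨hw.1, fun hd => hw.2.1 (hd.mono_right Finset.sdiff_subset), hcon⟩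
      refine ⟨w, hw.1, hw.2.1, fun hd => hw.2.2 ?_, hwU⟩
      exact Finset.subset_sdiff.2 ⟨hwU, hd⟩
    -- Uncrossing: `cr` is submodular and `ms` supermodular, so `U ∩ W` is tight and meets `M q`.
    -- Minimality of `U` gives `U ⊆ W`.
    have hno : ∀ W ⊆ I, x ∈ W → cr W ≤ ms W → ¬ Disjoint (M q) W → N w ⊆ W := by
      intro W hWI hxW hWt hqW
      have hsub : cr (U ∪ W) + cr (U ∩ W) ≤ cr U + cr W := card_crossing_union_add_inter_le R N U W
      have hunion : ms (U ∪ W) ≤ cr (U ∪ W) :=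
        hcut' _ (Finset.union_subset hUI hWI) (Finset.mem_union_left _ hxU)
      have hinter : ms (U ∩ W) ≤ cr (U ∩ W) :=
        hcut' _ (Finset.inter_subset_left.trans hUI) (Finset.mem_inter.2 ⟨hxU, hxW⟩)
      have hpt : ∀ p, ((if Disjoint (M p) U then 1 else 0) + if Disjoint (M p) W then 1 else 0) ≤
          ((if Disjoint (M p) (U ∪ W) then 1 else 0) +
            if Disjoint (M p) (U ∩ W) then 1 else 0) := by
        intro p
        have e3 : Disjoint (M p) U → Disjoint (M p) (U ∩ W) :=
          fun h => h.mono_right Finset.inter_subset_left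
        have e4 : Disjoint (M p) W → Disjoint (M p) (U ∩ W) :=
          fun h => h.mono_right Finset.inter_subset_right
        by_cases d1 : Disjoint (M p) U <;> by_cases d2 : Disjoint (M p) W <;>
          simp [Finset.disjoint_union_right, d1, d2, e3, e4]
      have hsuper : ms U + ms W ≤ ms (U ∪ W) + ms (U ∩ W) := by
        simp only [ms, Finset.card_filter, ← Finset.sum_add_distrib]
        exact Finset.sum_le_sum fun p _ => hpt p
      have hmeet : ¬ Disjoint (M q) (U ∩ W) := by
        intro hd
        have : ms U + ms W < ms (U ∪ W) + ms (U ∩ W) := by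
          simp only [ms, Finset.card_filter, ← Finset.sum_add_distrib]
          refine Finset.sum_lt_sum (fun p _ => hpt p) ⟨q, hq, ?_⟩
          simp [hqU, hqW, hd]
        omega
      have hle := hUmin (U ∩ W) ⟨Finset.inter_subset_left.trans hUI,
        Finset.mem_inter.2 ⟨hxU, hxW⟩, by omega, hmeet⟩
      have := Finset.eq_of_subset_of_card_le Finset.inter_subset_left hle
      exact hwU.trans (Finset.inter_eq_left.1 this)
    -- Spend `w` on `q`. A cut `W` crossed by `w` loses one connector: if `M q` misses `W`, then `q`
    -- no longer demands one there; otherwise `W` is not tight by `hno`.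
    let M' : κ → Finset ι := Function.update M q (M q ∪ N w)
    have hM'q : M' q = M q ∪ N w := Function.update_self ..
    have hM'p : ∀ p, p ≠ q → M' p = M p := fun p hp => Function.update_of_ne hp ..
    obtain ⟨f, hf⟩ := ih (R.erase w) M' (by rw [Finset.card_erase_of_mem hwR, hR]; rfl)
      (by
        intro p hp
        by_cases hpq : p = q
        · subst hpq
          rw [hM'q]
          exact ⟨Finset.union_subset (hM p hp).1 (hN w hwR),
            (hM p hp).2.mono Finset.subset_union_left⟩
        · rw [hM'p p hpq]
          exact hM p hp)
      (fun v hv => hN v (Finset.mem_of_mem_erase hv))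
      (by
        intro W hWI hxW
        have h0 := hcut' W hWI hxW
        have hms : (Q.filter fun p => Disjoint (M' p) W).card ≤ ms W := by
          refine Finset.card_le_card (Finset.monotone_filter_right _ fun p _ hp => ?_)
          by_cases hpq : p = q
          · subst hpq
            rw [hM'q] at hp
            exact hp.mono_left Finset.subset_union_left
          · rwa [hM'p p hpq] at hp
        have her : ((R.erase w).filter fun v => ¬ Disjoint (N v) W ∧ ¬ N v ⊆ W) =
            (R.filter fun v => ¬ Disjoint (N v) W ∧ ¬ N v ⊆ W).erase w :=
          Finset.filter_erase ..
        rw [her]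
        by_cases hwW : ¬ Disjoint (N w) W ∧ ¬ N w ⊆ W
        · have hcr : ((R.filter fun v => ¬ Disjoint (N v) W ∧ ¬ N v ⊆ W).erase w).card + 1 =
              cr W :=
            Finset.card_erase_add_one (Finset.mem_filter.2 ⟨hwR, hwW⟩)
          by_cases hqW : Disjoint (M q) W
          · have : (Q.filter fun p => Disjoint (M' p) W).card < ms W := by
              refine Finset.card_lt_card (Finset.ssubset_iff_of_subset ?_ |>.2 ⟨q, ?_, ?_⟩)
              · refine Finset.monotone_filter_right _ fun p _ hp => ?_
                by_cases hpq : p = q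
                · subst hpq
                  exact hqW
                · rwa [hM'p p hpq] at hp
              · simp [hq, hqW]
              · simp only [Finset.mem_filter, hM'q, Finset.disjoint_union_left]
                tauto
            omega
          · have : ¬ cr W ≤ ms W := fun h => hwW.2 (hno W hWI hxW h hqW)
            omega
        · rw [Finset.erase_eq_of_notMem (by simp only [Finset.mem_filter]; tauto)]
          exact hms.trans h0)
    refine ⟨Function.update f w q, fun p hp W hWI hxW hpW => ?_⟩
    have hlift : Disjoint (M' p) W →
        ∃ v ∈ R, Function.update f w q v = p ∧ ¬ Disjoint (N v) W ∧ ¬ N v ⊆ W := by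
      intro hd
      obtain ⟨v, hv, hvp, h⟩ := hf p hp W hWI hxW hd
      refine ⟨v, Finset.mem_of_mem_erase hv, ?_, h⟩
      rw [Function.update_of_ne (Finset.ne_of_mem_erase hv), hvp]
    by_cases hpq : p = q
    · subst hpq
      by_cases hwW : Disjoint (N w) W
      · exact hlift (by rw [hM'q]; exact Finset.disjoint_union_left.2 ⟨hpW, hwW⟩)
      · refine ⟨w, hwR, Function.update_self .., hwW, fun hs => hw2 ?_⟩
        exact (hpW.mono_right hs).symm
    · exact hlift (by rwa [hM'p p hpq])

/-! ### Independence number two -/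

section

variable {V : Type*} {G G' : SimpleGraph V} {S S' : Finset V} {a : ℕ}

theorem IndepLE.mono (hS : S' ⊆ S) (h : IndepLE G S a) : IndepLE G S' a :=
  fun J hJ hi => h J (hJ.trans hS) hi

theorem IndepLE.adj (h : IndepLE G S 2) {x y z : V} (hx : x ∈ S) (hy : y ∈ S) (hz : z ∈ S)
    (hxy : x ≠ y) (hxz : x ≠ z) (hyz : y ≠ z) (h1 : ¬ G.Adj x y) (h2 : ¬ G.Adj x z) :
    G.Adj y z := by
  classical
  by_contra h3
  have := h {x, y, z} (by simp [Finset.insert_subset_iff, hx, hy, hz]) (by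
    intro u hu v hv huv
    simp only [Finset.coe_insert, Finset.coe_singleton, Set.mem_insert_iff,
      Set.mem_singleton_iff] at hu hv
    rcases hu with rfl | rfl | rfl <;> rcases hv with rfl | rfl | rfl <;>
      first | exact absurd rfl huv | assumption | (rw [SimpleGraph.adj_comm]; assumption))
  rw [Finset.card_eq_three.2 ⟨x, y, z, hxy, hxz, hyz, rfl⟩] at this
  omega

/-- The vertices `a, b, c, d, e` form an induced cycle of length five, in this order. -/
structure IsPentagon (G : SimpleGraph V) (a b c d e : V) : Prop where
  ab : G.Adj a b
  bc : G.Adj b c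
  cd : G.Adj c d
  de : G.Adj d e
  ea : G.Adj e a
  ac : ¬ G.Adj a c
  bd : ¬ G.Adj b d
  ce : ¬ G.Adj c e
  da : ¬ G.Adj d a
  eb : ¬ G.Adj e b

theorem IsPentagon.rotate {a b c d e : V} (h : IsPentagon G a b c d e) :
    IsPentagon G b c d e a :=
  ⟨h.bc, h.cd, h.de, h.ea, h.ab, h.bd, h.ce, h.da, h.eb, h.ac⟩

theorem IsPentagon.ne {a b c d e : V} (h : IsPentagon G a b c d e) : a ≠ c := by
  rintro rfl
  exact h.da h.cd.symm

/-- There is a spanning subgraph that is edge-minimal for having no independent set of size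
three in `S`. -/
theorem IndepLE.exists_edge_minimal [Finite V] (h : IndepLE G S 2) :
    ∃ H ≤ G, IndepLE H S 2 ∧ ∀ x ∈ S, ∀ y ∈ S, H.Adj x y →
      ∃ p ∈ S, p ≠ x ∧ p ≠ y ∧ ¬ H.Adj p x ∧ ¬ H.Adj p y := by
  classical
  obtain ⟨H, ⟨hHG, hH⟩, hmin⟩ := (Set.toFinite {H : SimpleGraph V | H ≤ G ∧ IndepLE H S 2}).exists_minimal
    ⟨G, le_rfl, h⟩
  refine ⟨H, hHG, hH, fun x hx y hy hxy => ?_⟩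
  by_contra! hcon
  -- Without the required `p`, the edge `xy` could be deleted: a new independent triple would
  -- contain `x`, `y` and such a `p`.
  have hle : H.deleteEdges {s(x, y)} ≤ H := SimpleGraph.deleteEdges_le _
  have hgood : IndepLE (H.deleteEdges {s(x, y)}) S 2 := by
    intro J hJ hi
    by_cases hxyJ : x ∈ J ∧ y ∈ J
    · by_contra! hc
      obtain ⟨p, hp, hpn⟩ : ∃ p ∈ J, p ∉ ({x, y} : Finset V) := by
        refine Finset.exists_mem_notMem_of_card_lt_card (lt_of_le_of_lt Finset.card_le_two hc)
      simp only [Finset.mem_insert, Finset.mem_singleton, not_or] at hpn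
      have h1 : ∀ z ∈ J, p ≠ z → ¬ H.Adj p z := by
        intro z hz hpz hadj
        refine hi hp hz hpz ?_
        rw [SimpleGraph.deleteEdges_adj]
        refine ⟨hadj, ?_⟩
        simp only [Set.mem_singleton_iff, Sym2.eq_iff]
        tauto
      exact h1 y hxyJ.2 hpn.2 (hcon p (hJ hp) hpn.1 hpn.2 (h1 x hxyJ.1 hpn.1))
    · refine hH J hJ fun u hu v hv huv hadj => hi hu hv huv ?_
      rw [SimpleGraph.deleteEdges_adj]
      refine ⟨hadj, ?_⟩
      simp only [Set.mem_singleton_iff, Sym2.eq_iff]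
      rintro (⟨rfl, rfl⟩ | ⟨rfl, rfl⟩)
      · exact hxyJ ⟨hu, hv⟩
      · exact hxyJ ⟨hv, hu⟩
  have := hmin ⟨hle.trans hHG, hgood⟩ hle hxy
  rw [SimpleGraph.deleteEdges_adj] at this
  exact this.2 rfl

/-- If adjacency is transitive, `S` splits into at most two cliques. Otherwise take an induced path
`x y z`: the vertices that minimality supplies for the edges `xy` and `yz` close it to a pentagon.
-/
theorem IndepLE.exists_pentagon_or_isClique (h : IndepLE G S 2)
    (hmin : ∀ x ∈ S, ∀ y ∈ S, G.Adj x y →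
      ∃ p ∈ S, p ≠ x ∧ p ≠ y ∧ ¬ G.Adj p x ∧ ¬ G.Adj p y) :
    (∃ a ∈ S, ∃ b ∈ S, ∃ c ∈ S, ∃ d ∈ S, ∃ e ∈ S, IsPentagon G a b c d e) ∨
      ∃ K ⊆ S, G.IsClique K ∧ S.card ≤ 2 * K.card := by
  classical
  by_cases htr : ∀ x ∈ S, ∀ y ∈ S, ∀ z ∈ S, G.Adj x y → G.Adj y z → x ≠ z → G.Adj x z
  · right
    rcases S.eq_empty_or_nonempty with rfl | ⟨o, ho⟩
    · exact ⟨∅, subset_rfl, by simp, by simp⟩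
    have h1 : G.IsClique (S.filter fun v => v = o ∨ G.Adj v o : Finset V) := by
      intro u hu v hv huv
      simp only [Finset.coe_filter, Set.mem_ofPred_eq] at hu hv
      rcases hu with ⟨hu, rfl | hu'⟩ <;> rcases hv with ⟨hv, rfl | hv'⟩
      · exact absurd rfl huv
      · exact hv'.symm
      · exact hu'
      · exact htr u hu o ho v hv hu' hv'.symm huv
    have h2 : G.IsClique (S.filter fun v => ¬ (v = o ∨ G.Adj v o) : Finset V) := by
      intro u hu v hv huv
      simp only [Finset.coe_filter, Set.mem_ofPred_eq, not_or] at hu hv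
      exact h.adj ho hu.1 hv.1 (Ne.symm hu.2.1) (Ne.symm hv.2.1) huv
        (fun hh => hu.2.2 hh.symm) (fun hh => hv.2.2 hh.symm)
    have h3 := Finset.card_filter_add_card_filter_not (s := S) (fun v => v = o ∨ G.Adj v o)
    rcases le_total (S.filter fun v => v = o ∨ G.Adj v o).card
      (S.filter fun v => ¬ (v = o ∨ G.Adj v o)).card with hle | hle
    · exact ⟨_, Finset.filter_subset _ _, h2, by omega⟩
    · exact ⟨_, Finset.filter_subset _ _, h1, by omega⟩
  · left
    push Not at htr
    obtain ⟨x, hx, y, hy, z, hz, hxy, hyz, hxz, hnxz⟩ := htr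
    obtain ⟨p, hp, hpx, hpy, hnpx, hnpy⟩ := hmin x hx y hy hxy
    obtain ⟨q, hq, hqy, hqz, hnqy, hnqz⟩ := hmin y hy z hz hyz
    have hpz : p ≠ z := fun hh => hnpy (hh ▸ hyz.symm)
    have hqx : q ≠ x := fun hh => hnqy (hh ▸ hxy)
    have hzp : G.Adj z p := h.adj hx hz hp hxz (Ne.symm hpx) (Ne.symm hpz) hnxz
      (fun hh => hnpx hh.symm)
    have hqx' : G.Adj q x := h.adj hz hq hx (Ne.symm hqz) (Ne.symm hxz) hqx
      (fun hh => hnqz hh.symm) (fun hh => hnxz hh.symm)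
    have hpq : p ≠ q := fun hh => hnpx (hh ▸ hqx')
    have hpq' : G.Adj p q := h.adj hy hp hq (Ne.symm hpy) (Ne.symm hqy) hpq
      (fun hh => hnpy hh.symm) (fun hh => hnqy hh.symm)
    exact ⟨x, hx, y, hy, z, hz, p, hp, q, hq, hxy, hyz, hzp, hpq', hqx', hnxz,
      fun hh => hnpy hh.symm, fun hh => hnqz hh.symm, hnpx, hnqy⟩

open Classical in
/-- Among the outside vertices, few miss two given consecutive vertices of a suitable rotation of
the pentagon. -/
theorem IsPentagon.exists_rotation {a b c d e : V} (hP : IsPentagon G a b c d e)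
    (ha : a ∈ S) (hb : b ∈ S) (hc : c ∈ S) (hd : d ∈ S) (he : e ∈ S) {O : Finset V}
    (hO : ∀ v ∈ O, v ∈ S ∧ v ∉ ({a, b, c, d, e} : Finset V)) (h : IndepLE G S 2) :
    ∃ a' ∈ S, ∃ b' ∈ S, ∃ c' ∈ S, ∃ d' ∈ S, ∃ e' ∈ S, IsPentagon G a' b' c' d' e' ∧
      ({a', b', c', d', e'} : Finset V) = {a, b, c, d, e} ∧
      5 * (O.filter fun v => ¬ G.Adj v d' ∧ ¬ G.Adj v e').card ≤ O.card := by
  -- An outside vertex sees one of any two non-adjacent pentagon vertices, so it misses at most one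
  -- consecutive pair.
  have hsum : (O.filter fun v => ¬ G.Adj v a ∧ ¬ G.Adj v b).card +
      (O.filter fun v => ¬ G.Adj v b ∧ ¬ G.Adj v c).card +
      (O.filter fun v => ¬ G.Adj v c ∧ ¬ G.Adj v d).card +
      (O.filter fun v => ¬ G.Adj v d ∧ ¬ G.Adj v e).card +
      (O.filter fun v => ¬ G.Adj v e ∧ ¬ G.Adj v a).card ≤ O.card := by
    simp only [Finset.card_filter, ← Finset.sum_add_distrib]
    rw [Finset.card_eq_sum_ones]
    refine Finset.sum_le_sum fun v hv => ?_
    obtain ⟨hvS, hvC⟩ := hO v hv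
    simp only [Finset.mem_insert, Finset.mem_singleton, not_or] at hvC
    have key : ∀ p q, p ∈ S → q ∈ S → v ≠ p → v ≠ q → p ≠ q → ¬ G.Adj p q →
        G.Adj v p ∨ G.Adj v q := by
      intro p q hp hq hvp hvq hpq hn
      by_contra! hcon
      exact hn (h.adj hvS hp hq hvp hvq hpq hcon.1 hcon.2)
    have k1 := key a c ha hc hvC.1 hvC.2.2.1 hP.ne hP.ac
    have k2 := key b d hb hd hvC.2.1 hvC.2.2.2.1 hP.rotate.ne hP.bd
    have k3 := key c e hc he hvC.2.2.1 hvC.2.2.2.2 hP.rotate.rotate.ne hP.ce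
    have k4 := key d a hd ha hvC.2.2.2.1 hvC.1 hP.rotate.rotate.rotate.ne hP.da
    have k5 := key e b he hb hvC.2.2.2.2 hvC.2.1 hP.rotate.rotate.rotate.rotate.ne hP.eb
    by_cases va : G.Adj v a <;> by_cases vb : G.Adj v b <;> by_cases vc : G.Adj v c <;>
      by_cases vd : G.Adj v d <;> by_cases ve : G.Adj v e <;> simp_all
  by_contra hcon
  have hlt : ∀ a' ∈ S, ∀ b' ∈ S, ∀ c' ∈ S, ∀ d' ∈ S, ∀ e' ∈ S, IsPentagon G a' b' c' d' e' →
      ({a', b', c', d', e'} : Finset V) = {a, b, c, d, e} →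
      O.card < 5 * (O.filter fun v => ¬ G.Adj v d' ∧ ¬ G.Adj v e').card := by
    intro a' ha' b' hb' c' hc' d' hd' e' he' hP' hs
    by_contra! hle
    exact hcon ⟨a', ha', b', hb', c', hc', d', hd', e', he', hP', hs, hle⟩
  have h1 := hlt a ha b hb c hc d hd e he hP rfl
  have h2 := hlt b hb c hc d hd e he a ha hP.rotate (by ext v; simp; tauto)
  have h3 := hlt c hc d hd e he a ha b hb hP.rotate.rotate (by ext v; simp; tauto)
  have h4 := hlt d hd e he a ha b hb c hc hP.rotate.rotate.rotate (by ext v; simp; tauto)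
  have h5 := hlt e he a ha b hb c hc d hd hP.rotate.rotate.rotate.rotate
    (by ext v; simp; tauto)
  omega

open Classical in
/-- A vertex of a large set has few non-neighbours outside the pentagon, unless these form a large
clique. -/
theorem card_nonadj_add_two_le {x y z : V} (h : IndepLE G S 2) (hx : x ∈ S) (hy : y ∈ S)
    (hz : z ∈ S) (hxy : ¬ G.Adj x y) (hxz : ¬ G.Adj x z) (nxy : x ≠ y) (nxz : x ≠ z)
    (nyz : y ≠ z) {O : Finset V} (hO : ∀ v ∈ O, v ∈ S ∧ v ≠ x ∧ v ≠ y ∧ v ≠ z) {t : ℕ}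
    (hK : ∀ K ⊆ S, G.IsClique K → K.card < t) :
    (O.filter fun v => ¬ G.Adj v x).card + 2 < t := by
  -- The non-neighbours of `x` form a clique, and `y`, `z` are two of them outside `O`.
  have hlt := hK (S.filter fun v => v ≠ x ∧ ¬ G.Adj v x) (Finset.filter_subset _ _) (by
    intro u hu v hv huv
    simp only [Finset.coe_filter, Set.mem_ofPred_eq] at hu hv
    exact h.adj hx hu.1 hv.1 (Ne.symm hu.2.1) (Ne.symm hv.2.1) huv
      (fun hh => hu.2.2 hh.symm) (fun hh => hv.2.2 hh.symm))
  refine lt_of_le_of_lt ?_ hlt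
  have hd : Disjoint (O.filter fun v => ¬ G.Adj v x) {y, z} := by
    rw [Finset.disjoint_left]
    intro v hv hv'
    have := hO v (Finset.mem_filter.1 hv).1
    simp only [Finset.mem_insert, Finset.mem_singleton] at hv'
    tauto
  rw [← Finset.card_pair nyz, ← Finset.card_union_of_disjoint hd]
  refine Finset.card_le_card fun v hv => ?_
  rw [Finset.mem_union, Finset.mem_filter, Finset.mem_insert, Finset.mem_singleton] at hv
  rw [Finset.mem_filter]
  rcases hv with ⟨hv, hv'⟩ | rfl | rfl
  · exact ⟨(hO v hv).1, (hO v hv).2.1, hv'⟩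
  · exact ⟨hy, Ne.symm nxy, fun hh => hxy hh.symm⟩
  · exact ⟨hz, Ne.symm nxz, fun hh => hxz hh.symm⟩

end

open Classical in
/-- Each vertex of `Q` that misses `a` or `c` can be given its own connector: a vertex outside of
`Q` that sees the missed vertex, and `d` or `e`. -/
theorem exists_private_connectors {V : Type*} {G : SimpleGraph V} {O Q : Finset V} {a c d e : V}
    (hQO : Q ⊆ O) (kac : ∀ v ∈ O, G.Adj v a ∨ G.Adj v c)
    (hcard : Q.card + (O.filter fun v => ¬ G.Adj v d ∧ ¬ G.Adj v e).card ≤ (O \ Q).card)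
    (hma : (O.filter fun v => ¬ G.Adj v a).card +
      (O.filter fun v => ¬ G.Adj v d ∧ ¬ G.Adj v e).card ≤ (O \ Q).card)
    (hmc : (O.filter fun v => ¬ G.Adj v c).card +
      (O.filter fun v => ¬ G.Adj v d ∧ ¬ G.Adj v e).card ≤ (O \ Q).card) :
    ∃ f : (Q.filter fun q => ¬ G.Adj q a ∨ ¬ G.Adj q c : Finset V) → V, Function.Injective f ∧
      ∀ q : (Q.filter fun q => ¬ G.Adj q a ∨ ¬ G.Adj q c : Finset V),
        f q ∈ (O \ Q).filter fun v => (G.Adj v d ∨ G.Adj v e) ∧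
        (¬ G.Adj (q : V) a → G.Adj v a) ∧ (¬ G.Adj (q : V) c → G.Adj v c) := by
  let A : V → Finset V := fun q => (O \ Q).filter fun v => (G.Adj v d ∨ G.Adj v e) ∧
    (¬ G.Adj q a → G.Adj v a) ∧ (¬ G.Adj q c → G.Adj v c)
  let D : Finset V := Q.filter fun q => ¬ G.Adj q a ∨ ¬ G.Adj q c
  change ∃ f : D → V, Function.Injective f ∧ ∀ q : D, f q ∈ A q
  -- Hall's theorem. If all of `X` misses the same vertex `a` or `c`, the count uses `hma` or `hmc`;
  -- otherwise `hcard` suffices, because every outside vertex sees `a` or `c` and so can serve some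
  -- member of `X`.
  rw [← Finset.all_card_le_biUnion_card_iff_exists_injective (fun q : D => A q)]
  intro X
  have hXQ : ∀ q : D, (q : V) ∈ Q := fun q => (Finset.mem_filter.1 q.2).1
  have hXcard : (X.map (Function.Embedding.subtype _)).card = X.card := Finset.card_map _
  have hsplit : ∀ (p : V → Prop) [DecidablePred p],
      (O.filter p).card = (Q.filter p).card + ((O \ Q).filter p).card := by
    intro p _
    rw [← Finset.card_union_of_disjoint (Finset.disjoint_filter_filter Finset.disjoint_sdiff),
      ← Finset.filter_union, Finset.union_sdiff_of_subset hQO]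
  have hside : ∀ z, (∀ v ∈ O, ∀ q : D, q ∈ X → v ∈ O \ Q → (G.Adj v d ∨ G.Adj v e) →
      G.Adj v z → v ∈ A q) → (∀ q : D, q ∈ X → ¬ G.Adj q z) → X.Nonempty →
      (O.filter fun v => ¬ G.Adj v z).card +
      (O.filter fun v => ¬ G.Adj v d ∧ ¬ G.Adj v e).card ≤ (O \ Q).card →
      X.card ≤ (X.biUnion fun q : D => A q).card := by
    intro z hz hXz hne hm
    obtain ⟨q₀, hq₀⟩ := hne
    have h1 : X.card ≤ (Q.filter fun v => ¬ G.Adj v z).card := by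
      rw [← hXcard]
      refine Finset.card_le_card fun v hv => ?_
      obtain ⟨q, hq, rfl⟩ := Finset.mem_map.1 hv
      exact Finset.mem_filter.2 ⟨hXQ q, hXz q hq⟩
    have h2 : (O \ Q) ⊆ ((O \ Q).filter fun v => ¬ G.Adj v z) ∪
        (O.filter fun v => ¬ G.Adj v d ∧ ¬ G.Adj v e) ∪ X.biUnion fun q : D => A q := by
      intro v hv
      have hvO := (Finset.mem_sdiff.1 hv).1
      by_cases h3 : G.Adj v z
      · by_cases h4 : ¬ G.Adj v d ∧ ¬ G.Adj v e
        · exact Finset.mem_union_left _ (Finset.mem_union_right _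
            (Finset.mem_filter.2 ⟨hvO, h4⟩))
        · exact Finset.mem_union_right _ (Finset.mem_biUnion.2 ⟨q₀, hq₀,
            hz v hvO q₀ hq₀ hv (by tauto) h3⟩)
      · exact Finset.mem_union_left _ (Finset.mem_union_left _
          (Finset.mem_filter.2 ⟨hv, h3⟩))
    have h3 := (Finset.card_le_card h2).trans (Finset.card_union_le _ _)
    have h4 := Finset.card_union_le ((O \ Q).filter fun v => ¬ G.Adj v z)
      (O.filter fun v => ¬ G.Adj v d ∧ ¬ G.Adj v e)
    have h5 := hsplit fun v => ¬ G.Adj v z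
    omega
  rcases X.eq_empty_or_nonempty with rfl | hne
  · simp
  by_cases hXa : ∀ q : D, q ∈ X → ¬ G.Adj q a
  · refine hside a (fun v hvO q hq hv hde hva => ?_) hXa hne hma
    refine Finset.mem_filter.2 ⟨hv, hde, fun _ => hva, fun hqc => ?_⟩
    exact absurd (kac q (hQO (hXQ q))) (by have := hXa q hq; tauto)
  by_cases hXc : ∀ q : D, q ∈ X → ¬ G.Adj q c
  · refine hside c (fun v hvO q hq hv hde hvc => ?_) hXc hne hmc
    refine Finset.mem_filter.2 ⟨hv, hde, fun hqa => ?_, fun _ => hvc⟩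
    exact absurd (kac q (hQO (hXQ q))) (by have := hXc q hq; tauto)
  push Not at hXa hXc
  obtain ⟨q₁, hq₁, hq₁a⟩ := hXa
  obtain ⟨q₂, hq₂, hq₂c⟩ := hXc
  have h1 : X.card ≤ Q.card := by
    rw [← hXcard]
    refine Finset.card_le_card fun v hv => ?_
    obtain ⟨q, hq, rfl⟩ := Finset.mem_map.1 hv
    exact hXQ q
  have h2 : (O \ Q) ⊆ (O.filter fun v => ¬ G.Adj v d ∧ ¬ G.Adj v e) ∪
      X.biUnion fun q : D => A q := by
    intro v hv
    have hvO := (Finset.mem_sdiff.1 hv).1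
    by_cases h4 : ¬ G.Adj v d ∧ ¬ G.Adj v e
    · exact Finset.mem_union_left _ (Finset.mem_filter.2 ⟨hvO, h4⟩)
    · refine Finset.mem_union_right _ (Finset.mem_biUnion.2 ?_)
      rcases kac v hvO with hva | hvc
      · exact ⟨q₂, hq₂, Finset.mem_filter.2 ⟨hv, by tauto, by tauto, by tauto⟩⟩
      · exact ⟨q₁, hq₁, Finset.mem_filter.2 ⟨hv, by tauto, by tauto, by tauto⟩⟩
  have h3 := (Finset.card_le_card h2).trans (Finset.card_union_le _ _)
  omega

open Classical in
/-- Two opposite vertices `a`, `c` of a pentagon extend a clique immersion outside of it. -/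
theorem IsPentagon.extend {V : Type*} {G : SimpleGraph V} {S O Q : Finset V} {a b c d e : V}
    (hP : IsPentagon G a b c d e)
    (ha : a ∈ S) (hb : b ∈ S) (hc : c ∈ S) (hd : d ∈ S) (he : e ∈ S)
    (hO : O = S \ {a, b, c, d, e}) (h : IndepLE G S 2) (hQO : Q ⊆ O)
    (hQ : Linked (within G O) Q)
    (hcard : Q.card + (O.filter fun v => ¬ G.Adj v d ∧ ¬ G.Adj v e).card ≤ (O \ Q).card)
    (hma : (O.filter fun v => ¬ G.Adj v a).card +
      (O.filter fun v => ¬ G.Adj v d ∧ ¬ G.Adj v e).card ≤ (O \ Q).card)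
    (hmc : (O.filter fun v => ¬ G.Adj v c).card +
      (O.filter fun v => ¬ G.Adj v d ∧ ¬ G.Adj v e).card ≤ (O \ Q).card) :
    LinkedIn G S (Q.card + 2) := by
  set C : Finset V := {a, b, c, d, e} with hC
  have hCS : C ⊆ S := by simp [hC, Finset.insert_subset_iff, ha, hb, hc, hd, he]
  have haC : a ∈ C := by simp [hC]
  have hbC : b ∈ C := by simp [hC]
  have hcC : c ∈ C := by simp [hC]
  have hdC : d ∈ C := by simp [hC]
  have heC : e ∈ C := by simp [hC]
  have hOC : ∀ v ∈ O, v ∈ S ∧ v ∉ C := fun v hv => by rw [hO] at hv; exact Finset.mem_sdiff.1 hv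
  have hOS : O ⊆ S := fun v hv => (hOC v hv).1
  have key : ∀ v ∈ O, ∀ p q, p ∈ C → q ∈ C → p ≠ q → ¬ G.Adj p q →
      G.Adj v p ∨ G.Adj v q := by
    intro v hv p q hp hq hpq hn
    by_contra! hcon
    refine hn (h.adj (hOC v hv).1 (hCS hp) (hCS hq) ?_ ?_ hpq hcon.1 hcon.2)
    · rintro rfl
      exact (hOC v hv).2 hp
    · rintro rfl
      exact (hOC v hv).2 hq
  have nac := hP.ne
  have nbd := hP.rotate.ne
  have nce := hP.rotate.rotate.ne
  have nda := hP.rotate.rotate.rotate.ne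
  have neb := hP.rotate.rotate.rotate.rotate.ne
  have kac := fun v hv => key v hv a c haC hcC nac hP.ac
  have kbd := fun v hv => key v hv b d hbC hdC nbd hP.bd
  have kce := fun v hv => key v hv c e hcC heC nce hP.ce
  have kda := fun v hv => key v hv d a hdC haC nda hP.da
  have keb := fun v hv => key v hv e b heC hbC neb hP.eb
  let A : V → Finset V := fun q => (O \ Q).filter fun v => (G.Adj v d ∨ G.Adj v e) ∧
    (¬ G.Adj q a → G.Adj v a) ∧ (¬ G.Adj q c → G.Adj v c)
  let D : Finset V := Q.filter fun q => ¬ G.Adj q a ∨ ¬ G.Adj q c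
  obtain ⟨f, hfinj, hf⟩ : ∃ f : D → V, Function.Injective f ∧ ∀ q : D, f q ∈ A q :=
    exists_private_connectors hQO kac hcard hma hmc
  have hfR : ∀ q : D, f q ∈ O ∧ f q ∉ Q ∧ (G.Adj (f q) d ∨ G.Adj (f q) e) ∧
      (¬ G.Adj q a → G.Adj (f q) a) ∧ (¬ G.Adj q c → G.Adj (f q) c) := by
    intro q
    have := Finset.mem_filter.1 (hf q)
    exact ⟨(Finset.mem_sdiff.1 this.1).1, (Finset.mem_sdiff.1 this.1).2, this.2⟩
  -- `True` marks the edges of the paths to `a`, `False` those of the paths to `c`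
  obtain ⟨g, hg⟩ : ∃ g : V → V, ∀ q : D, g (f q) = q := by
    refine ⟨fun v => if hv : ∃ q : D, f q = v then hv.choose else v, fun q => ?_⟩
    have hv : ∃ q' : D, f q' = f q := ⟨q, rfl⟩
    simp only [dif_pos hv]
    exact congrArg _ (hfinj hv.choose_spec)
  -- A label names the owner and the target. An edge from `q` to its target carries that target's
  -- label. If `q` misses `a` or `c`, its edges to `b`, `d`, `e` and all edges of its connector `f
  -- q` go to the missed one.
  let L : V → V → V × Prop := fun z o =>
    if o ∈ Q then (o, z = a ∨ (¬ G.Adj o a ∧ z ≠ c)) else (g o, ¬ G.Adj (g o) a)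
  have hLQ : ∀ z, ∀ o ∈ Q, L z o = (o, z = a ∨ (¬ G.Adj o a ∧ z ≠ c)) :=
    fun z o ho => if_pos ho
  have hLf : ∀ z, ∀ q : D, L z (f q) = ((q : V), ¬ G.Adj (q : V) a) := by
    intro z q
    simp only [L, if_neg (hfR q).2.1, hg]
  have hadj : ∀ {y v}, y ∈ C → v ∈ O → G.Adj v y → (within G S).Adj y v :=
    fun hy hv hvy => ⟨hvy.symm, hCS hy, hOS hv⟩
  -- The detour `q`, `y`, `v`, `z`, with `v` the private connector of `q` and `y` a common neighbour
  -- in the pentagon.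
  have hreach : ∀ q ∈ Q, ∀ p : Prop, ∀ z ∈ C, ∀ y ∈ C, ∀ v ∈ O, G.Adj q y → G.Adj v y →
      G.Adj v z → L y q = (q, p) → L y v = (q, p) → L z v = (q, p) →
      (labelled (within G S) C L (q, p)).Reachable q z := by
    intro q hq p z hz y hy v hv hqy hvy hvz l1 l2 l3
    have e1 := labelled_adj (hadj hy (hQO hq) hqy) hy (hOC q (hQO hq)).2 l1
    have e2 := labelled_adj (hadj hy hv hvy) hy (hOC v hv).2 l2
    have e3 := labelled_adj (hadj hz hv hvz) hz (hOC v hv).2 l3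
    exact (e1.symm.reachable.trans e2.reachable).trans e3.symm.reachable
  have hreach_a : ∀ q ∈ Q, (labelled (within G S) C L (q, True)).Reachable q a := by
    intro q hq
    by_cases hqa : G.Adj q a
    · exact (labelled_adj (hadj haC (hQO hq) hqa) haC (hOC q (hQO hq)).2 (by simp [hLQ _ _ hq])).symm.reachable
    have hqD : q ∈ D := Finset.mem_filter.2 ⟨hq, Or.inl hqa⟩
    obtain ⟨h1, -, h3, h4, -⟩ := hfR ⟨q, hqD⟩
    have hl : ∀ z, L z (f ⟨q, hqD⟩) = (q, True) := fun z => by rw [hLf]; simp [hqa]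
    have hl' : ∀ z, z ≠ c → L z q = (q, True) := fun z hz => by rw [hLQ _ _ hq]; simp [hqa, hz]
    have hqO := hQO hq
    have q1 := kda q hqO
    have q2 := keb q hqO
    have v1 := kbd _ h1
    -- Missing `a` forces `q` to see `d`. If the connector misses `d`, it sees `e` and `b`, one of
    -- which `q` sees.
    by_cases hvd : G.Adj (f ⟨q, hqD⟩) d
    · exact hreach q hq _ a haC d hdC _ h1 (q1.resolve_right hqa) hvd (h4 hqa) (hl' d hP.cd.ne.symm) (hl _)
        (hl _)
    · rcases q2 with hqe | hqb
      · exact hreach q hq _ a haC e heC _ h1 hqe (h3.resolve_left hvd) (h4 hqa) (hl' e nce.symm) (hl _)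
          (hl _)
      · exact hreach q hq _ a haC b hbC _ h1 hqb (v1.resolve_right hvd) (h4 hqa) (hl' b hP.bc.ne) (hl _)
          (hl _)
  have hreach_c : ∀ q ∈ Q, (labelled (within G S) C L (q, False)).Reachable q c := by
    intro q hq
    by_cases hqc : G.Adj q c
    · exact (labelled_adj (hadj hcC (hQO hq) hqc) hcC (hOC q (hQO hq)).2
        (by simp [hLQ _ _ hq, nac.symm])).symm.reachable
    have hqD : q ∈ D := Finset.mem_filter.2 ⟨hq, Or.inr hqc⟩
    obtain ⟨h1, -, h3, -, h4⟩ := hfR ⟨q, hqD⟩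
    have hqO := hQO hq
    have hqa : G.Adj q a := (kac q hqO).resolve_right hqc
    have hl : ∀ z, L z (f ⟨q, hqD⟩) = (q, False) := fun z => by rw [hLf]; simp [hqa]
    have hl' : ∀ z, z ≠ a → L z q = (q, False) := fun z hz => by rw [hLQ _ _ hq]; simp [hqa, hz]
    have q1 := kce q hqO
    have q2 := kbd q hqO
    have v1 := keb _ h1
    by_cases hve : G.Adj (f ⟨q, hqD⟩) e
    · exact hreach q hq _ c hcC e heC _ h1 (q1.resolve_left hqc) hve (h4 hqc) (hl' e hP.ea.ne) (hl _)
        (hl _)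
    · rcases q2 with hqb | hqd
      · exact hreach q hq _ c hcC b hbC _ h1 hqb (v1.resolve_left hve) (h4 hqc) (hl' b hP.ab.ne.symm) (hl _)
          (hl _)
      · exact hreach q hq _ c hcC d hdC _ h1 hqd (h3.resolve_right hve) (h4 hqc) (hl' d nda) (hl _)
          (hl _)
  have hdOC : Disjoint O C := Finset.disjoint_left.2 fun v hv => (hOC v hv).2
  have haQ : a ∉ Q := fun hh => (hOC a (hQO hh)).2 haC
  have hcQ : c ∉ Q := fun hh => (hOC c (hQO hh)).2 hcC
  have h1 := hQ.insert_branch haQ (fun q => labelled (within G S) C L (q, True))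
    (fun p q hpq => labelled_disjoint L (by simpa using hpq))
    (fun q => within_disjoint_labelled L _ (Or.inr hdOC)) hreach_a
  -- The pair `a`, `c` is joined through `b` by pentagon edges, which no label uses.
  let K : V → SimpleGraph V := fun q =>
    if q = a then within G C else labelled (within G S) C L (q, False)
  have hKa : K a = within G C := if_pos rfl
  have hKq : ∀ q, q ≠ a → K q = labelled (within G S) C L (q, False) := fun q hq => if_neg hq
  have h2 := h1.insert_branch (x := c) (by simp [hcQ, nac.symm]) K
    (by
      intro p q hpq
      by_cases hp : p = a
      · subst hp
        rw [hKa, hKq q (Ne.symm hpq)]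
        exact within_disjoint_labelled L _ (Or.inl subset_rfl)
      · by_cases hq : q = a
        · subst hq
          rw [hKa, hKq p hp]
          exact (within_disjoint_labelled L _ (Or.inl subset_rfl)).symm
        · rw [hKq p hp, hKq q hq]
          exact labelled_disjoint L (by simpa using hpq))
    (by
      intro q
      rw [disjoint_sup_left, iSup_disjoint_iff]
      by_cases hq : q = a
      · subst hq
        rw [hKa]
        exact ⟨within_disjoint_within hdOC,
          fun p => (within_disjoint_labelled L _ (Or.inl subset_rfl)).symm⟩
      · rw [hKq q hq]
        exact ⟨within_disjoint_labelled L _ (Or.inr hdOC),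
          fun p => labelled_disjoint L (by simp)⟩)
    (by
      intro q hq
      rcases Finset.mem_insert.1 hq with rfl | hq
      · rw [hKa]
        have e1 : (within G C).Adj q b := ⟨hP.ab, haC, hbC⟩
        have e2 : (within G C).Adj b c := ⟨hP.bc, hbC, hcC⟩
        exact e1.reachable.trans e2.reachable
      · rw [hKq q (fun hh => haQ (hh ▸ hq))]
        exact hreach_c q hq)
  refine ⟨insert c (insert a Q), ?_, ?_, h2.mono ?_ subset_rfl⟩
  · exact Finset.insert_subset hc (Finset.insert_subset ha (hQO.trans hOS))
  · rw [Finset.card_insert_of_notMem (by simp [hcQ, nac.symm]), Finset.card_insert_of_notMem haQ]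
  · refine sup_le (sup_le (within_mono le_rfl hOS) (iSup_le fun _ => labelled_le))
      (iSup_le fun q => ?_)
    by_cases hq : q = a
    · subst hq
      rw [hKa]
      exact within_mono le_rfl hCS
    · rw [hKq q hq]
      exact labelled_le

/-- Each step costs the five vertices of a pentagon and gains two branch vertices. If there is no
pentagon, half of the vertices form a clique, which is large enough. -/
theorem linkedIn_of_indepLE_two {V : Type*} [Finite V] (k : ℕ) : ∀ (G : SimpleGraph V)
    (S : Finset V), 5 * k ≤ S.card → IndepLE G S 2 → LinkedIn G S (2 * k) := by
  classical
  induction k with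
  | zero => exact fun G S _ _ => linkedIn_zero G S
  | succ k ih =>
    intro G₀ S hS h₀
    obtain ⟨G, hG, h, hmin⟩ := h₀.exists_edge_minimal
    refine LinkedIn.mono hG subset_rfl le_rfl ?_
    by_contra hcon
    have hK : ∀ K ⊆ S, G.IsClique K → K.card < 2 * (k + 1) := by
      intro K hKS hK
      by_contra! hle
      exact hcon (linkedIn_of_isClique hKS hK hle)
    rcases h.exists_pentagon_or_isClique hmin with
      ⟨a₀, ha₀, b₀, hb₀, c₀, hc₀, d₀, hd₀, e₀, he₀, hP₀⟩ | ⟨K, hKS, hKc, hKcard⟩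
    · set O := S \ {a₀, b₀, c₀, d₀, e₀} with hO
      obtain ⟨a, ha, b, hb, c, hc, d, hd, e, he, hP, hset, hT⟩ :=
        hP₀.exists_rotation ha₀ hb₀ hc₀ hd₀ he₀ (O := O) (fun v hv => Finset.mem_sdiff.1 hv) h
      rw [← hset] at hO
      have hOcard : S.card ≤ O.card + 5 := by
        have h1 := Finset.le_card_sdiff ({a, b, c, d, e} : Finset V) S
        have h2 : ({a, b, c, d, e} : Finset V).card ≤ 5 := Finset.card_le_five
        rw [← hO] at h1
        omega
      obtain ⟨Q, hQO, hQc, hQ⟩ := ih G O (by omega)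
        (h.mono (hO ▸ Finset.sdiff_subset))
      have hOv : ∀ v ∈ O, v ∈ S ∧ v ≠ a ∧ v ≠ b ∧ v ≠ c ∧ v ≠ d ∧ v ≠ e := by
        intro v hv
        rw [hO] at hv
        simpa using hv
      have hma := card_nonadj_add_two_le h ha hc hd hP.ac (fun hh => hP.da hh.symm) hP.ne
        hP.rotate.rotate.rotate.ne.symm hP.cd.ne (O := O)
        (fun v hv => by have := hOv v hv; tauto) hK
      have hmc := card_nonadj_add_two_le h hc ha he (fun hh => hP.ac hh.symm) hP.ce hP.ne.symm
        hP.rotate.rotate.ne hP.ea.ne.symm (O := O)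
        (fun v hv => by have := hOv v hv; tauto) hK
      have hR : (O \ Q).card + Q.card = O.card := Finset.card_sdiff_add_card_eq_card hQO
      refine hcon ?_
      -- With `5 * k ≤ O.card` and at most `O.card / 5` vertices missing both `d` and `e`, the first
      -- bound follows from `2 * (2 * k) ≤ 4 * O.card / 5`; the others hold as `a` and `c` each have
      -- fewer than `2 * k` non-neighbours in `O`.
      have := hP.extend ha hb hc hd he hO h hQO hQ (by omega) (by omega) (by omega)
      rw [hQc] at this
      exact this
    · have := hK K hKS hKc
      omega

/-! ### Adding a vertex of a maximum independent set -/

section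

variable {V : Type*} [DecidableEq V] {G : SimpleGraph V} {S : Finset V}

/-- Outside a maximum independent set `I`, any `x ∈ I` can be added to a clique immersion when
every cut of `I` is crossed by many vertices. -/
theorem Linked.exists_insert {I Q : Finset V} (hIS : I ⊆ S) (hQS : Q ⊆ S \ I)
    (hQ : Linked (within G (S \ I)) Q) {x : V} (hx : x ∈ I)
    (hI : ∀ v ∈ S \ I, ∃ i ∈ I, G.Adj v i)
    (hcut : ∀ U ⊆ I, U.Nonempty → U ≠ I → ∃ X ⊆ S \ I, Q.card ≤ X.card ∧
      ∀ v ∈ X, (∃ i ∈ U, G.Adj v i) ∧ ∃ i ∈ I \ U, G.Adj v i) :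
    LinkedIn G S (Q.card + 1) := by
  classical
  let N : V → Finset V := fun v => I.filter fun i => G.Adj v i
  have hN : ∀ v i, i ∈ N v ↔ i ∈ I ∧ G.Adj v i := fun v i => Finset.mem_filter
  have hNd : ∀ v U, U ⊆ I → (¬ Disjoint (N v) U ↔ ∃ i ∈ U, G.Adj v i) := by
    intro v U hU
    rw [Finset.not_disjoint_iff]
    exact ⟨fun ⟨i, hi, hiU⟩ => ⟨i, hiU, ((hN v i).1 hi).2⟩,
      fun ⟨i, hiU, hi⟩ => ⟨i, (hN v i).2 ⟨hU hiU, hi⟩, hiU⟩⟩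
  have hNs : ∀ v U, (¬ N v ⊆ U ↔ ∃ i ∈ I \ U, G.Adj v i) := by
    intro v U
    rw [Finset.not_subset]
    exact ⟨fun ⟨i, hi, hiU⟩ => ⟨i, Finset.mem_sdiff.2 ⟨((hN v i).1 hi).1, hiU⟩, ((hN v i).1 hi).2⟩,
      fun ⟨i, hiU, hi⟩ => ⟨i, (hN v i).2 ⟨(Finset.mem_sdiff.1 hiU).1, hi⟩,
        (Finset.mem_sdiff.1 hiU).2⟩⟩
  have : Nonempty V := ⟨x⟩
  -- Outside vertices not in `Q` are the connectors, and each `q` is attached to its own neighbours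
  -- in `I`.
  obtain ⟨f, hf⟩ := exists_connector_assignment I hx Q N _ ((S \ I) \ Q) N rfl
    (fun q hq => ⟨Finset.filter_subset _ _, by
      obtain ⟨i, hi, hqi⟩ := hI q (hQS hq)
      exact ⟨i, (hN q i).2 ⟨hi, hqi⟩⟩⟩)
    (fun w _ => Finset.filter_subset _ _)
    (by
      intro U hU hxU
      by_cases hUI : U = I
      · subst hUI
        have : (Q.filter fun q => Disjoint (N q) U) = ∅ := by
          refine Finset.filter_eq_empty_iff.2 fun q hq => ?_
          exact (hNd q U subset_rfl).2 (hI q (hQS hq))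
        simp [this]
      -- Crossing vertices that lie in `Q` are no connectors, but they make no demand either:
      -- compare `X \ Q` with `Q \ X`.
      · obtain ⟨X, hXS, hXc, hX⟩ := hcut U hU ⟨x, hxU⟩ hUI
        have h1 : X \ Q ⊆ ((S \ I) \ Q).filter fun w => ¬ Disjoint (N w) U ∧ ¬ N w ⊆ U := by
          intro v hv
          obtain ⟨hvX, hvQ⟩ := Finset.mem_sdiff.1 hv
          exact Finset.mem_filter.2 ⟨Finset.mem_sdiff.2 ⟨hXS hvX, hvQ⟩,
            (hNd v U hU).2 (hX v hvX).1, (hNs v U).2 (hX v hvX).2⟩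
        have h2 : (Q.filter fun q => Disjoint (N q) U) ⊆ Q \ X := by
          intro q hq
          obtain ⟨hq, hqd⟩ := Finset.mem_filter.1 hq
          exact Finset.mem_sdiff.2 ⟨hq, fun hqX => (hNd q U hU).2 (hX q hqX).1 hqd⟩
        have h3 := Finset.card_le_card h1
        have h4 := Finset.card_le_card h2
        have h5 := Finset.card_sdiff_add_card_inter X Q
        have h6 := Finset.card_sdiff_add_card_inter Q X
        rw [Finset.inter_comm] at h6
        omega)
  -- All edges from an outside vertex to `I` go to one owner, so the label ignores the end in `I`.
  let L : V → V → V := fun _ o => if o ∈ Q then o else f o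
  have hLQ : ∀ i, ∀ q ∈ Q, L i q = q := fun i q hq => if_pos hq
  have hLR : ∀ i, ∀ w ∉ Q, L i w = f w := fun i w hw => if_neg hw
  have hdisj : Disjoint (S \ I) I := Finset.sdiff_disjoint
  have hxQ : x ∉ Q := fun hh => (Finset.mem_sdiff.1 (hQS hh)).2 hx
  have hadj : ∀ {y v}, y ∈ I → v ∈ S \ I → G.Adj v y → (within G S).Adj y v :=
    fun hy hv hvy => ⟨hvy.symm, hIS hy, (Finset.mem_sdiff.1 hv).1⟩
  have hr : ∀ q ∈ Q, (labelled (within G S) I L q).Reachable q x := by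
    intro q hq
    by_contra hcon
    have hqI : q ∉ I := (Finset.mem_sdiff.1 (hQS hq)).2
    obtain ⟨w, hw, hwq, h1, h2⟩ := hf q hq
      (I.filter fun i => (labelled (within G S) I L q).Reachable i x) (Finset.filter_subset _ _)
      (Finset.mem_filter.2 ⟨hx, SimpleGraph.Reachable.refl _⟩) (by
        rw [Finset.disjoint_left]
        intro i hi hi'
        have hadj := labelled_adj (hadj ((hN q i).1 hi).1 (hQS hq) ((hN q i).1 hi).2) ((hN q i).1 hi).1 hqI (hLQ i q hq)
        exact hcon (hadj.symm.reachable.trans (Finset.mem_filter.1 hi').2))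
    rw [hNd _ _ (Finset.filter_subset _ _)] at h1
    rw [hNs] at h2
    obtain ⟨i, hi, hwi⟩ := h1
    obtain ⟨j, hj, hwj⟩ := h2
    obtain ⟨hiI, hix⟩ := Finset.mem_filter.1 hi
    obtain ⟨hjI, hjx⟩ := Finset.mem_sdiff.1 hj
    obtain ⟨hwSI, hwQ⟩ := Finset.mem_sdiff.1 hw
    have hwI := (Finset.mem_sdiff.1 hwSI).2
    have e1 := labelled_adj (hadj hiI hwSI hwi) hiI hwI ((hLR i w hwQ).trans hwq)
    have e2 := labelled_adj (hadj hjI hwSI hwj) hjI hwI ((hLR j w hwQ).trans hwq)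
    exact hjx (Finset.mem_filter.2 ⟨hjI, (e2.reachable.trans e1.symm.reachable).trans hix⟩)
  have h1 := hQ.insert_branch hxQ (fun q => labelled (within G S) I L q) (fun p q hpq => labelled_disjoint L hpq)
    (fun q => within_disjoint_labelled L _ (Or.inr hdisj)) hr
  refine ⟨insert x Q, ?_, Finset.card_insert_of_notMem hxQ, h1.mono ?_ subset_rfl⟩
  · exact Finset.insert_subset (hIS hx) (hQS.trans Finset.sdiff_subset)
  · exact sup_le (within_mono le_rfl Finset.sdiff_subset) (iSup_le fun _ => labelled_le)

end

/-! ### Induction on the independence number -/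

/-- Any independent set in `W` stays independent when `U` is added. -/
theorem IndepLE.sub_of_not_adj {V : Type*} {G : SimpleGraph V} {S U W : Finset V} {a : ℕ}
    (h : IndepLE G S a) (hUS : U ⊆ S) (hU : G.IsIndepSet U) (hWS : W ⊆ S)
    (hd : Disjoint W U) (hW : ∀ v ∈ W, ∀ i ∈ U, ¬ G.Adj v i) :
    IndepLE G W (a - U.card) := by
  classical
  intro J hJ hi
  have := h (J ∪ U) (Finset.union_subset (hJ.trans hWS) hUS) (by
    intro u hu v hv huv
    rw [Finset.mem_coe, Finset.mem_union] at hu hv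
    rcases hu with hu | hu <;> rcases hv with hv | hv
    · exact hi hu hv huv
    · exact hW u (hJ hu) v hv
    · exact fun hh => hW v (hJ hv) u hu hh.symm
    · exact hU hu hv huv)
  rw [Finset.card_union_of_disjoint (hd.mono_left hJ)] at this
  omega

/-- Ensures that deleting `α` independent vertices costs at most `β α`, the price of one branch
vertex. -/
theorem natCast_le_of_step {β : ℕ → ℚ} (hβ₁ : β 1 = 1) (hβ₂ : β 2 = 5 / 2)
    (hβ_step : ∀ i : ℕ, 3 ≤ i → β (i - 1) + 2 ≤ β i) (i : ℕ) (hi : 1 ≤ i) : (i : ℚ) ≤ β i := by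
  induction i, hi using Nat.le_induction with
  | base => simp [hβ₁]
  | succ i hi ih =>
    rcases hi.eq_or_lt with rfl | hi
    · norm_num [hβ₂]
    · have := hβ_step (i + 1) (by omega)
      simp only [Nat.add_sub_cancel] at this
      push_cast
      linarith

/-- Only the consequence `β s + β t + 1 ≤ β α` for `s + t = α` of the conditions on `β` is used. -/
theorem linkedIn_of_superadditive {V : Type*} [Finite V] {β : ℕ → ℚ} (hβ₁ : β 1 = 1)
    (hβ₂ : β 2 = 5 / 2) (hβ : ∀ i : ℕ, 1 ≤ i → (i : ℚ) ≤ β i)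
    (hsum : ∀ i : ℕ, 3 ≤ i → ∀ s t : ℕ, 1 ≤ s → 1 ≤ t → s + t = i → β s + β t + 1 ≤ β i)
    (α : ℕ) (hα : 1 ≤ α) (G : SimpleGraph V) : ∀ (k : ℕ) (S : Finset V), β α * k ≤ S.card →
      IndepLE G S α → LinkedIn G S (k - 1) := by
  classical
  induction α using Nat.strong_induction_on with
  | _ α ihα =>
  obtain rfl | rfl | hα3 : α = 1 ∨ α = 2 ∨ 3 ≤ α := by omega
  · intro k S hk h
    rw [hβ₁, one_mul, Nat.cast_le] at hk
    refine linkedIn_of_isClique subset_rfl (fun u hu v hv huv => ?_) ((Nat.sub_le k 1).trans hk)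
    by_contra hn
    have := h {u, v} (by
      rw [Finset.insert_subset_iff, Finset.singleton_subset_iff]
      exact ⟨hu, hv⟩) (by
      rw [Finset.coe_pair]
      exact Set.pairwise_pair.2 fun _ => ⟨hn, fun hh => hn hh.symm⟩)
    rw [Finset.card_pair huv] at this
    omega
  · intro k S hk h
    have hk' : 5 * k ≤ 2 * S.card := by
      rw [hβ₂] at hk
      have : (5 * k : ℚ) ≤ 2 * S.card := by linarith
      exact_mod_cast this
    -- Only an even number of branch vertices is produced; for odd `k` the `- 1` absorbs the loss.
    refine (linkedIn_of_indepLE_two (S.card / 5) G S (by omega) h).mono le_rfl subset_rfl ?_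
    omega
  · intro k
    induction k with
    | zero => exact fun S _ _ => linkedIn_zero G S
    | succ k ihk =>
      intro S hk h
      rcases Nat.eq_zero_or_pos k with rfl | hkpos
      · exact linkedIn_zero G S
      by_contra hcon
      -- In a counterexample every subset with smaller independence number is small, by the
      -- induction on `α`.
      have hsmall : ∀ i, 1 ≤ i → i < α → ∀ W ⊆ S, IndepLE G W i →
          (W.card : ℚ) < β i * (k + 1 : ℕ) := by
        intro i hi hiα W hWS hW
        by_contra! hle
        exact hcon ((ihα i hiα hi (k + 1) W hle hW).mono le_rfl hWS le_rfl)
      obtain ⟨I, hIS, hIi, hIα⟩ : ∃ I ⊆ S, G.IsIndepSet I ∧ I.card = α := by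
        by_contra! hno
        have h1 : IndepLE G S (α - 1) := by
          intro J hJ hi
          have h2 := h J hJ hi
          have h3 := hno J hJ hi
          omega
        have h2 := hsmall (α - 1) (by omega) (by omega) S subset_rfl h1
        have h3 := hsum α hα3 (α - 1) 1 (by omega) le_rfl (by omega)
        have h4 : β (α - 1) * ((k + 1 : ℕ) : ℚ) ≤ β α * ((k + 1 : ℕ) : ℚ) :=
          mul_le_mul_of_nonneg_right (by linarith) (Nat.cast_nonneg _)
        linarith
      have hcard : (S \ I).card + I.card = S.card := Finset.card_sdiff_add_card_eq_card hIS
      have hcardQ : ((S \ I).card : ℚ) + α = S.card := by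
        rw [← hIα]
        exact_mod_cast hcard
      obtain ⟨Q, hQS, hQc, hQ⟩ := ihk (S \ I) (by
        have := hβ α hα
        push_cast at hk
        linarith) (h.mono Finset.sdiff_subset)
      have hIne : I.Nonempty := Finset.card_pos.1 (by omega)
      obtain ⟨x, hx⟩ := hIne
      have key := Linked.exists_insert hIS hQS hQ hx ?_ ?_
      · rw [hQc] at key
        exact hcon (key.mono le_rfl subset_rfl (by omega))
      · intro v hv
        obtain ⟨hvS, hvI⟩ := Finset.mem_sdiff.1 hv
        by_contra! hno
        have := h.sub_of_not_adj hIS hIi (W := {v}) (by simpa using hvS) (by simpa using hvI)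
          (by simpa using hno) {v} subset_rfl (by simp)
        rw [Finset.card_singleton] at this
        omega
      · intro U hUI hUne hUI'
        -- Vertices missing `U`, together with `I \ U`, have independence number at most `α -
        -- U.card`. Including `I \ U` matters: over both sides these terms sum to `α`, the number of
        -- vertices lost by removing `I`.
        have hside : ∀ U ⊆ I, U.Nonempty → U ≠ I →
            (((S \ I).filter fun v => ∀ i ∈ U, ¬ G.Adj v i).card : ℚ) + (I \ U).card <
              β (I \ U).card * (k + 1 : ℕ) := by
          intro U hUI hUne hUI'
          have hdc : (I \ U).card + U.card = I.card := Finset.card_sdiff_add_card_eq_card hUI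
          have hUpos := hUne.card_pos
          have hlt := Finset.card_lt_card (hUI.ssubset_of_ne hUI')
          have hd : Disjoint ((S \ I).filter fun v => ∀ i ∈ U, ¬ G.Adj v i) (I \ U) :=
            Finset.disjoint_left.2 fun v hv hv' =>
              (Finset.mem_sdiff.1 (Finset.mem_filter.1 hv).1).2 (Finset.mem_sdiff.1 hv').1
          have hsub : ((S \ I).filter fun v => ∀ i ∈ U, ¬ G.Adj v i) ∪ (I \ U) ⊆ S :=
            Finset.union_subset ((Finset.filter_subset _ _).trans Finset.sdiff_subset)
              (Finset.sdiff_subset.trans hIS)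
          have hW := hsmall (I \ U).card (by omega) (by omega) _ hsub (by
            have := h.sub_of_not_adj (hUI.trans hIS)
              (fun u hu v hv huv => hIi (hUI hu) (hUI hv) huv) hsub ?_ ?_
            · rwa [show α - U.card = (I \ U).card by omega] at this
            · refine Finset.disjoint_union_left.2 ⟨?_, Finset.sdiff_disjoint⟩
              exact Finset.disjoint_left.2 fun v hv hv' =>
                (Finset.mem_sdiff.1 (Finset.mem_filter.1 hv).1).2 (hUI hv')
            · intro v hv i hi
              rcases Finset.mem_union.1 hv with hv | hv
              · exact (Finset.mem_filter.1 hv).2 i hi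
              · obtain ⟨hvI, hvU⟩ := Finset.mem_sdiff.1 hv
                exact hIi hvI (hUI hi) fun hh => hvU (hh ▸ hi))
          rw [Finset.card_union_of_disjoint hd] at hW
          exact_mod_cast hW
        refine ⟨(S \ I).filter fun v => (∃ i ∈ U, G.Adj v i) ∧ ∃ i ∈ I \ U, G.Adj v i,
          Finset.filter_subset _ _, ?_, fun v hv => (Finset.mem_filter.1 hv).2⟩
        have h1 := hside U hUI hUne hUI'
        have hdc : (I \ U).card + U.card = I.card := Finset.card_sdiff_add_card_eq_card hUI
        have hlt := Finset.card_lt_card (hUI.ssubset_of_ne hUI')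
        have hUpos := hUne.card_pos
        have h2 := hside (I \ U) Finset.sdiff_subset (Finset.card_pos.1 (by omega)) (by
          intro hh
          rw [hh] at hdc
          omega)
        rw [Finset.sdiff_sdiff_eq_self hUI] at h2
        have hcover : (S \ I) ⊆ ((S \ I).filter fun v => ∀ i ∈ U, ¬ G.Adj v i) ∪
            ((S \ I).filter fun v => ∀ i ∈ I \ U, ¬ G.Adj v i) ∪
            ((S \ I).filter fun v => (∃ i ∈ U, G.Adj v i) ∧ ∃ i ∈ I \ U, G.Adj v i) := by
          intro v hv
          rw [Finset.mem_union, Finset.mem_union, Finset.mem_filter, Finset.mem_filter,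
            Finset.mem_filter]
          by_cases hv1 : ∃ i ∈ U, G.Adj v i
          · by_cases hv2 : ∃ i ∈ I \ U, G.Adj v i
            · exact Or.inr ⟨hv, hv1, hv2⟩
            · exact Or.inl (Or.inr ⟨hv, fun i hi hvi => hv2 ⟨i, hi, hvi⟩⟩)
          · exact Or.inl (Or.inl ⟨hv, fun i hi hvi => hv1 ⟨i, hi, hvi⟩⟩)
        have h3 := (Finset.card_le_card hcover).trans
          ((Finset.card_union_le _ _).trans (Nat.add_le_add_right (Finset.card_union_le _ _) _))
        have h4 : ((S \ I).card : ℚ) ≤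
            ((S \ I).filter fun v => ∀ i ∈ U, ¬ G.Adj v i).card +
            ((S \ I).filter fun v => ∀ i ∈ I \ U, ¬ G.Adj v i).card +
            ((S \ I).filter fun v => (∃ i ∈ U, G.Adj v i) ∧ ∃ i ∈ I \ U, G.Adj v i).card := by
          exact_mod_cast h3
        have h5 := hsum α hα3 (I \ U).card U.card (by omega) (by omega) (by omega)
        have h6 := mul_le_mul_of_nonneg_right h5 (Nat.cast_nonneg (α := ℚ) (k + 1))
        have h7 : ((I \ U).card : ℚ) + U.card = α := by
          rw [← hIα]
          exact_mod_cast hdc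
        -- The two contributions of `I` cancel `α`, leaving `(β α - β s - β t) * (k + 1)` with `s`,
        -- `t` the sizes of the two sides.
        have h8 : ((k + 1 : ℕ) : ℚ) <
            ((S \ I).filter fun v => (∃ i ∈ U, G.Adj v i) ∧ ∃ i ∈ I \ U, G.Adj v i).card := by
          linarith
        rw [Nat.cast_lt] at h8
        omega

end CliqueImmersion

/-! ### The theorem -/

theorem theorem3p2 (β : ℕ → ℚ) (hβ₁ : β 1 = 1) (hβ₂ : β 2 = 5 / 2)
    (hβ_step : ∀ i : ℕ, 3 ≤ i → β (i - 1) + 2 ≤ β i)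
    (hβ_sum : ∀ i : ℕ, 3 ≤ i → ∀ s t : ℕ, 2 ≤ s → s ≤ i - 2 → 2 ≤ t → t ≤ i - 2 → s + t = i →
      β s + β t + (2 * (i : ℚ) - 1) / (i : ℚ) ≤ β i)
    {V : Type*} [Fintype V] (G : SimpleGraph V) (n α : ℕ)
    (hn : Fintype.card V = n) (hα : 1 ≤ α) (hG : G.indepNum ≤ α) :
    ∃ t : ℕ, ⌊(n : ℚ) / β α⌋ - 1 ≤ (t : ℤ) ∧
      (⊤ : SimpleGraph (Fin t)).IsImmersedIn G := by
  have hβ := CliqueImmersion.natCast_le_of_step hβ₁ hβ₂ hβ_step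
  have hsum : ∀ i : ℕ, 3 ≤ i → ∀ s t : ℕ, 1 ≤ s → 1 ≤ t → s + t = i →
      β s + β t + 1 ≤ β i := by
    intro i hi s t hs ht hst
    have hstep := hβ_step i hi
    obtain rfl | hs2 : s = 1 ∨ 2 ≤ s := by omega
    -- A part of size one is covered by the step condition, since `β 1 + 1 = 2`.
    · obtain rfl : t = i - 1 := by omega
      linarith
    obtain rfl | ht2 : t = 1 ∨ 2 ≤ t := by omega
    · obtain rfl : s = i - 1 := by omega
      linarith
    have h1 := hβ_sum i hi s t hs2 (by omega) ht2 (by omega) hst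
    have hi' : (3 : ℚ) ≤ i := by exact_mod_cast hi
    have h2 : 1 ≤ (2 * (i : ℚ) - 1) / (i : ℚ) := by
      rw [le_div_iff₀ (by linarith)]
      linarith
    linarith
  have hpos : 0 < β α := lt_of_lt_of_le (by exact_mod_cast hα) (hβ α hα)
  -- Truncated subtraction is harmless: a zero floor only asks for at least `-1` vertices.
  refine ⟨⌊(n : ℚ) / β α⌋₊ - 1, ?_, ?_⟩
  · have := Int.natCast_floor_eq_floor (div_nonneg (Nat.cast_nonneg n) hpos.le)
    omega
  · refine (CliqueImmersion.linkedIn_of_superadditive hβ₁ hβ₂ hβ hsum α hα G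
      ⌊(n : ℚ) / β α⌋₊ Finset.univ ?_ ?_).isImmersedIn
    · rw [Finset.card_univ, hn, mul_comm, ← le_div_iff₀ hpos]
      exact Nat.floor_le (div_nonneg (Nat.cast_nonneg n) hpos.le)
    · intro J _ hJ
      exact hJ.card_le_indepNum.trans hG
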